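/- Let $\mathcal X$ be a finite state space. A stochastic process $P_{\mathcal X}$ is a coherent conditional probability specifying $P_{\mathcal X}(A\mid X_u=x_u)$ for every finite (possibly empty) set $u\subset\mathbb R_{\ge 0}$, every $x_u\in\mathcal X^u$ and every event $A$ in the algebra generated by the events $(X_s=y)$ with $s\in u$ or $s>\max u$. Given a non-empty, bounded, convex set $\mathcal Q$ of rate matrices with separately specified rows and a non-empty set $\mathcal M$ of probability mass functions on $\mathcal X$, let $\mathbb P_{\mathcal Q,\mathcal M}$ be the set of all well-behaved processes (the difference quotients of all history-dependent transition matrices are bounded near step size $0$) with initial distribution in $\mathcal M$ for which all limit points, as the step size tends to $0$, of the left and right difference quotients of the transition matrices lie in $\mathcal Q$, at all times and for all histories. Given an output model, i.e. an algebra $\Sigma$ on a set $\mathcal Y$ and finitely additive probabilities $P_{\mathcal Y|\mathcal X}(\cdot\mid x)$ on it for $x\in\mathcal X$, the imprecise continuous-time hidden Markov chain (ICTHMC) $\mathcal Z$ is the set of all $P=P_{\mathcal Y|\mathcal X}\otimes P_{\mathcal X}$, $P_{\mathcal X}\in\mathbb P_{\mathcal Q,\mathcal M}$, in which each output $Y_t$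 is distributed according to $P_{\mathcal Y|\mathcal X}(\cdot\mid X_t)$, conditionally independent of everything else given $X_t$. For events $O_u=\times_{t\in u}O_t$ with $O_t\in\Sigma$ let $$\underline{\mathbb E}_{\mathcal Z}[f(X_v)\mid Y_u\in O_u]=\inf\{\mathbb E_P[f(X_v)\mid Y_u\in O_u]: P\in\mathcal Z,\ P(Y_u\in O_u)>0\},$$ which is defined if $\sup_{P\in\mathcal Z}P(Y_u\in O_u)>0$. If events $O_u^i$ decrease to $\{y_u\}$, let $\mathbb E_P[f(X_v)\mid Y_u=y_u]=\lim_i\mathbb E_P[f(X_v)\mid Y_u\in O^i_u]$; and if moreover $\phi_u(y_u\mid x_u)=\lim_i \lambda_i^{-1}\prod_{t\in u}P_{\mathcal Y|\mathcal X}(O_t^i\mid x_t)$ exists and is real-valued for all $x_u$, for some $\lambda_i>0$, let $$\underline{\mathbb E}^{\mathrm R}_{\mathcal Z}[f(X_v)\mid Y_u=y_u]=\inf\{\mathbb E_P[f(X_v)\mid Y_u=y_u]: P\in\mathcal Z,\ \mathbb E_{P}[\phi_u(y_u\mid X_u)]>0\},$$ which is defined if $\overline{\mathbb E}_{\mathcal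 Q,\mathcal M}[\phi_u(y_u\mid X_u)]=\sup_{P\in\mathcal Z}\mathbb E_P[\phi_u(y_u\mid X_u)]>0$. **Proposition.** There is an ICTHMC $\mathcal Z$ with $\mathcal X=\{x,\overline x\}$, with $\mathcal M$ the set of all probability mass functions on $\mathcal X$, with $\mathcal Y=[-1,1]$ and $\Sigma$ its Borel sets, and with $P_{\mathcal Y|\mathcal X}(O\mid x)=\int_O\tfrac12\,dy$ and $P_{\mathcal Y|\mathcal X}(O\mid\overline x)=\int_O|y|\,dy$, such that the following holds for $u=v=\{0\}$, $y_0=0$, $f(x)=1$, $f(\overline x)=-1$ and every non-increasing sequence $\delta_i\in(0,1]$ with $\delta_i\to0$, with $O^i_0=(-\delta_i,\delta_i)$. The events $O^i_0$ shrink to $y_0$; there are $\lambda_i>0$ for which $\phi(y_0\mid X_0)$ exists, is real-valued and satisfies $\overline{\mathbb E}_{\mathcal Q,\mathcal M}[\phi(y_0\mid X_0)]>0$; $\mathbb E_P[f(X_0)\mid Y_0=y_0]$ exists for every $P\in\mathcal Z$ with $\mathbb E_P[\phi(y_0\mid X_0)]>0$; each $\underline{\mathbb E}_{\mathcal Z}[f(X_0)\mid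 Y_0\in O_0^i]$ is defined; and $$\underline{\mathbb E}^{\mathrm R}_{\mathcal Z}[f(X_0)\mid Y_0=y_0]=1\neq-1=\lim_{i\to\infty}\underline{\mathbb E}_{\mathcal Z}[f(X_0)\mid Y_0\in O^i_0].$$ -/

import Mathlib

open Filter Topology MeasureTheory
open scoped NNReal

noncomputable section

/-! ### Stochastic processes as coherent conditional probabilities -/

/-- Paths of a continuous-time process with state space `X`. -/
abbrev CTPath (X : Type*) := ℝ≥0 → X

/-- The event `X_u = x_u` for a finite set `u` of time points; for `u = ∅` it is the sure event. -/
def stateEvent {X : Type*} (u : Finset ℝ≥0) (x : u → X) : Set (CTPath X) :=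
  {ω | ∀ t : u, ω t = x t}

/-- The algebra of events generated by the events `X_s = y` with `s ∈ u`, or `s` later than every
time point of `u`. -/
def futureAlgebra (X : Type*) (u : Finset ℝ≥0) : Set (Set (CTPath X)) :=
  generateSetAlgebra
    {A | ∃ (s : ℝ≥0) (y : X), (s ∈ u ∨ ∀ t ∈ u, t < s) ∧ A = {ω | ω s = y}}

/-- The pairs `(A, X_u = x_u)` on which the conditional probabilities `P(A | X_u = x_u)` of a
stochastic process are specified; `u` ranges over the finite, possibly empty, sets of time
points. -/
def condDomain (X : Type*) : Set (Set (CTPath X) × Set (CTPath X)) :=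
  {p | ∃ (u : Finset ℝ≥0) (x : u → X), p.1 ∈ futureAlgebra X u ∧ p.2 = stateEvent u x}

/-- Coherence (in the sense of de Finetti) of a conditional probability on the set `D` of pairs of
events: no finite combination of conditional bets on events of `D` loses uniformly on the union of
the conditioning events. (The sum takes finitely many values, so its supremum is attained.)
Only the values of `P` on `D` matter. -/
def CoherentOn {Ω : Type*} (D : Set (Set Ω × Set Ω)) (P : Set Ω → Set Ω → ℝ) : Prop :=
  ∀ (n : ℕ) (A C : Fin (n + 1) → Set Ω) (c : Fin (n + 1) → ℝ),
    (∀ i, (A i, C i) ∈ D) →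
    ∃ ω ∈ ⋃ i, C i,
      0 ≤ ∑ i, c i * (C i).indicator 1 ω * (P (A i) (C i) - (A i).indicator 1 ω)

/-- A continuous-time stochastic process with state space `X`: a coherent conditional probability
on the pairs `(A, X_u = x_u)`; `cond A C` is the probability of `A` given `C`. -/
structure StochProc (X : Type*) where
  cond : Set (CTPath X) → Set (CTPath X) → ℝ
  coherent : CoherentOn (condDomain X) cond

namespace StochProc

variable {X : Type*} (P : StochProc X)

/-- The unconditional probability `P(X_w = x_w)`. -/
def prob (w : Finset ℝ≥0) (x : w → X) : ℝ := P.cond (stateEvent w x) Set.univ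

/-- The expectation `E_P[g(X_w)]`. -/
def expect [Fintype X] (w : Finset ℝ≥0) (g : (w → X) → ℝ) : ℝ := ∑ x : w → X, P.prob w x * g x

/-- The history-dependent transition matrix from time `t` to time `s`, with entries
`P(X_s = y | X_t = x, X_u = x_u)`. It is used for `u < t ≤ s`. -/
def trans (u : Finset ℝ≥0) (xu : u → X) (t s : ℝ≥0) : Matrix X X ℝ :=
  Matrix.of fun x y => P.cond {ω | ω s = y} ({ω | ω t = x} ∩ stateEvent u xu)

/-- Well-behavedness: the difference quotients of the transition matrices stay bounded, from the
right at every time point and from the left at every positive time point, for every history. -/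
def WellBehaved [DecidableEq X] : Prop :=
  ∀ (t : ℝ≥0) (u : Finset ℝ≥0) (xu : u → X), (∀ r ∈ u, r < t) → ∀ x y : X,
    (∃ b : ℝ, ∀ᶠ h in 𝓝[>] (0 : ℝ≥0),
      |P.trans u xu t (t + h) x y - (1 : Matrix X X ℝ) x y| / (h : ℝ) ≤ b) ∧
    (0 < t → ∃ b : ℝ, ∀ᶠ h in 𝓝[>] (0 : ℝ≥0),
      |P.trans u xu (t - h) t x y - (1 : Matrix X X ℝ) x y| / (h : ℝ) ≤ b)

/-- The outer partial derivative of the transition matrices at time `t` and history `x_u`: all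
limits of difference quotients along step sizes that tend to zero, from the right or from the
left. For `t = 0` there are no admissible steps to the left. -/
def outerDeriv [DecidableEq X] (t : ℝ≥0) (u : Finset ℝ≥0) (xu : u → X) : Set (Matrix X X ℝ) :=
  {R | ∃ h : ℕ → ℝ≥0, (∀ i, 0 < h i) ∧ Tendsto h atTop (𝓝 0) ∧
      Tendsto (fun i => ((h i : ℝ))⁻¹ • (P.trans u xu t (t + h i) - 1)) atTop (𝓝 R)} ∪
  {R | ∃ h : ℕ → ℝ≥0, (∀ i, 0 < h i ∧ h i ≤ t ∧ ∀ r ∈ u, r < t - h i) ∧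
      Tendsto h atTop (𝓝 0) ∧
      Tendsto (fun i => ((h i : ℝ))⁻¹ • (P.trans u xu (t - h i) t - 1)) atTop (𝓝 R)}

end StochProc

/-! ### Imprecise continuous-time Markov chains -/

/-- Rate matrices: non-negative off-diagonal entries, and rows that sum to zero. -/
def IsRateMatrix {X : Type*} [Fintype X] (R : Matrix X X ℝ) : Prop :=
  (∀ x y, x ≠ y → 0 ≤ R x y) ∧ ∀ x, ∑ y, R x y = 0

/-- The imprecise continuous-time Markov chain with set of rate matrices `𝒬` and set of initial
distributions `ℳ`: all well-behaved stochastic processes whose initial distribution is in `ℳ` and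
whose outer partial derivatives, at all times and for all histories, are in `𝒬`. -/
def ictmc {X : Type*} [DecidableEq X] (𝒬 : Set (Matrix X X ℝ)) (ℳ : Set (X → ℝ)) :
    Set (StochProc X) :=
  {P | P.WellBehaved ∧
    (fun x => P.cond {ω | ω 0 = x} Set.univ) ∈ ℳ ∧
    ∀ (t : ℝ≥0) (u : Finset ℝ≥0) (xu : u → X), (∀ r ∈ u, r < t) → P.outerDeriv t u xu ⊆ 𝒬}

/-- The upper expectation of `g(X_w)` over an imprecise continuous-time Markov chain. -/
def upperExpect {X : Type*} [Fintype X] [DecidableEq X] (𝒬 : Set (Matrix X X ℝ))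
    (ℳ : Set (X → ℝ)) (w : Finset ℝ≥0) (g : (w → X) → ℝ) : ℝ :=
  sSup {e | ∃ P ∈ ictmc 𝒬 ℳ, e = P.expect w g}

/-! ### Output models and augmented processes -/

/-- An output model: an algebra of events on `Y` and, for every state `x`, a finitely additive
probability measure `prob x` on it (only its values on `events` matter). -/
structure OutputModel (X Y : Type*) where
  events : Set (Set Y)
  isAlgebra : IsSetAlgebra events
  prob : X → Set Y → ℝ
  prob_nonneg : ∀ x, ∀ O ∈ events, 0 ≤ prob x O
  prob_univ : ∀ x, prob x Set.univ = 1
  prob_union : ∀ x, ∀ O₁ ∈ events, ∀ O₂ ∈ events, Disjoint O₁ O₂ →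
    prob x (O₁ ∪ O₂) = prob x O₁ + prob x O₂

/-- The product `∏_{t ∈ u} P(O_t | x_t)`, that is, `P(O_u | x_u)`. -/
def OutputModel.probSeq {X Y : Type*} (𝒪 : OutputModel X Y) (u : Finset ℝ≥0) (x : u → X)
    (O : u → Set Y) : ℝ := ∏ t : u, 𝒪.prob (x t) (O t)

/-- The event `O_u = ×_{t ∈ u} O_t` as a subset of `Y_u`. -/
def box {Y : Type*} {u : Finset ℝ≥0} (O : u → Set Y) : Set (u → Y) := Set.univ.pi O

/-- The sequence of events `O^i_u`, which are products of events of the output model, shrinks to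
the point `y_u`. -/
def ShrinksTo {X Y : Type*} (𝒪 : OutputModel X Y) {u : Finset ℝ≥0} (O : ℕ → u → Set Y)
    (y : u → Y) : Prop :=
  (∀ i t, O i t ∈ 𝒪.events) ∧ (∀ i, box (O (i + 1)) ⊆ box (O i)) ∧ ⋂ i, box (O i) = {y}

/-- `φ` is the pointwise limit of `P(O^i_u | ·) / lam i`, and is real-valued. -/
def IsLimitDensity {X Y : Type*} (𝒪 : OutputModel X Y) {u : Finset ℝ≥0} (O : ℕ → u → Set Y)
    (lam : ℕ → ℝ) (φ : (u → X) → ℝ) : Prop :=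
  ∀ x : u → X, Tendsto (fun i => 𝒪.probSeq u x (O i) / lam i) atTop (𝓝 (φ x))

/-- The augmented stochastic process that combines an output model with a stochastic process. -/
structure AugmentedProc (X Y : Type*) where
  output : OutputModel X Y
  state : StochProc X

namespace AugmentedProc

variable {X Y : Type*} (P : AugmentedProc X Y)

/-- The joint probability `P(Y_u ∈ O_u, X_w = x_w)` for `u ⊆ w`: the outputs are conditionally
independent of each other and of all other variables, given the states at their own times. -/
def jointProb {u w : Finset ℝ≥0} (huw : u ⊆ w) (O : u → Set Y) (x : w → X) : ℝ :=
  P.output.probSeq u (fun t => x ⟨t, huw t.2⟩) O * P.state.prob w x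

/-- The marginal probability `P(Y_u ∈ O_u)`. -/
def outputProb [Fintype X] {u : Finset ℝ≥0} (O : u → Set Y) : ℝ :=
  ∑ x : u → X, P.jointProb (Finset.Subset.refl u) O x

open Classical in
/-- The marginal probability `P(X_v = x_v, Y_u ∈ O_u)`, where `u` and `v` may overlap. -/
def stateOutputProb [Fintype X] {u v : Finset ℝ≥0} (xv : v → X) (O : u → Set Y) : ℝ :=
  ∑ x : ↥(u ∪ v) → X, if (∀ t : v, x ⟨t, Finset.mem_union_right u t.2⟩ = xv t) then
    P.jointProb Finset.subset_union_left O x else 0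

/-- The updated expectation `E_P[f(X_v) | Y_u ∈ O_u]`, meaningful if `P(Y_u ∈ O_u) > 0`. -/
def condExpect [Fintype X] {u v : Finset ℝ≥0} (f : (v → X) → ℝ) (O : u → Set Y) : ℝ :=
  ∑ xv : v → X, f xv * (P.stateOutputProb xv O / P.outputProb O)

/-- `E_P[f(X_v) | Y_u = y_u]` exists and equals `e`, where the point `y_u` is approached along the
events `O^i_u`: all updated expectations given `Y_u ∈ O^i_u` are defined, and they tend to `e`. -/
def HasPointUpdate [Fintype X] {u v : Finset ℝ≥0} (f : (v → X) → ℝ) (O : ℕ → u → Set Y)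
    (e : ℝ) : Prop :=
  (∀ i, 0 < P.outputProb (O i)) ∧ Tendsto (fun i => P.condExpect f (O i)) atTop (𝓝 e)

end AugmentedProc

/-! ### Imprecise continuous-time hidden Markov chains -/

/-- The parameters of an imprecise continuous-time hidden Markov chain: a non-empty, bounded, convex
set of rate matrices with separately specified rows, a non-empty set of initial probability mass
functions, and an output model. -/
structure ICTHMC (X Y : Type*) [Fintype X] where
  rates : Set (Matrix X X ℝ)
  isRate : ∀ R ∈ rates, IsRateMatrix R
  rates_nonempty : rates.Nonempty
  rates_bounded : ∃ c : ℝ, ∀ R ∈ rates, ∀ x, |R x x| < c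
  rates_convex : Convex ℝ rates
  rates_rows : ∀ R : X → Matrix X X ℝ, (∀ x, R x ∈ rates) →
    (Matrix.of fun x y => R x x y) ∈ rates
  initial : Set (X → ℝ)
  isPmf : initial ⊆ stdSimplex ℝ X
  initial_nonempty : initial.Nonempty
  output : OutputModel X Y

namespace ICTHMC

variable {X Y : Type*} [Fintype X] [DecidableEq X] (Z : ICTHMC X Y)

/-- The set of augmented processes that constitutes the hidden Markov chain. -/
def procs : Set (AugmentedProc X Y) :=
  {P | ∃ PX ∈ ictmc Z.rates Z.initial, P = ⟨Z.output, PX⟩}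

/-- The upper probability of `Y_u ∈ O_u`. -/
def upperOutputProb {u : Finset ℝ≥0} (O : u → Set Y) : ℝ :=
  sSup {p | ∃ P ∈ Z.procs, p = P.outputProb O}

/-- The updated lower expectation of `f(X_v)` given the event `Y_u ∈ O_u` (regular extension),
meaningful if the upper probability of `Y_u ∈ O_u` is positive. -/
def lowerEvent {u v : Finset ℝ≥0} (f : (v → X) → ℝ) (O : u → Set Y) : ℝ :=
  sInf {e | ∃ P ∈ Z.procs, 0 < P.outputProb O ∧ e = P.condExpect f O}

/-- The updated lower expectation `E^R` of `f(X_v)` given `Y_u = y_u`, where `y_u` is approached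
along the events `O^i_u` and `φ` is the limit density: the infimum of the precise updated
expectations over the processes with `E_P[φ(X_u)] > 0`; meaningful if the upper expectation of
`φ(X_u)` is positive. -/
def lowerPointR {u v : Finset ℝ≥0} (f : (v → X) → ℝ) (O : ℕ → u → Set Y)
    (φ : (u → X) → ℝ) : ℝ :=
  sInf {e | ∃ P ∈ Z.procs, 0 < P.state.expect u φ ∧ P.HasPointUpdate f O e}

end ICTHMC

end

/-! ### Frozen processes: a process that never leaves its current state -/

section Frozen

variable {X : Type*}

/-! Write `p` for the initial probability of state `true` and `q = 1 - p`. The event `(-δ, δ)` has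
probability `δ` in state `true` and `δ ^ 2` in state `false`, so with scaling `δ` the limit density
is the indicator of `true`, and the updated expectation given the event is `(p - δ * q) / (p + δ *
q)`. For every `p > 0` this tends to `1`. For `p = 0` it equals `-1` for every `δ`. Conditioning on
the point by regular extension discards `p = 0`, where the expected density vanishes, and gives `1`;
each event still has positive probability `δ ^ 2` there, so each lower expectation given the event
is `-1`.

Everything happens at time `0`, so the dynamics matter only in that processes with initial
distributions `p = 1` and `p = 0` must exist in the chain. The process that never moves provides
them, as the zero matrix is an admissible rate matrix. The work lies in its coherence for all
conditioning events, including those that it gives probability zero (`coherentOn_frozenCond`). -/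

theorem mem_futureAlgebra_congr {u : Finset ℝ≥0} {A : Set (CTPath X)} (hA : A ∈ futureAlgebra X u)
    {ω ω' : CTPath X} (h : ∀ s, (s ∈ u ∨ ∀ t ∈ u, t < s) → ω s = ω' s) : ω ∈ A ↔ ω' ∈ A := by
  induction hA with
  | base s hs =>
    obtain ⟨r, y, hr, rfl⟩ := hs
    simp [h r hr]
  | empty => simp
  | compl s _ ih => simpa using not_congr ih
  | union s t _ _ ihs iht => simp only [Set.mem_union, ihs, iht]

variable [Nontrivial X]

open Classical in
/-- The path that takes the values `x` on `u` and the last of these values everywhere else. -/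
noncomputable def holdPath (u : Finset ℝ≥0) (x : u → X) : CTPath X := fun s =>
  if hs : s ∈ u then x ⟨s, hs⟩
  else if hu : u.Nonempty then x ⟨u.max' hu, u.max'_mem hu⟩ else Classical.arbitrary X

theorem holdPath_of_mem {u : Finset ℝ≥0} (x : u → X) {s : ℝ≥0} (hs : s ∈ u) :
    holdPath u x s = x ⟨s, hs⟩ := by simp [holdPath, hs]

theorem holdPath_mem (u : Finset ℝ≥0) (x : u → X) : holdPath u x ∈ stateEvent u x :=
  fun t => holdPath_of_mem x t.2

theorem holdPath_of_le {u : Finset ℝ≥0} (x : u → X) (hu : u.Nonempty) {s : ℝ≥0}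
    (hs : u.max' hu ≤ s) : holdPath u x s = x ⟨u.max' hu, u.max'_mem hu⟩ := by
  by_cases h : s ∈ u
  · have : s = u.max' hu := le_antisymm (u.le_max' s h) hs
    subst this
    exact holdPath_of_mem x h
  · simp [holdPath, h, hu]

/-- A time outside `u` is left free by `X_u = x`, and with at least two states the path can be
changed there to violate `X_v = y`. -/
theorem subset_of_stateEvent_subset {u v : Finset ℝ≥0} {x : u → X} {y : v → X}
    (h : stateEvent u x ⊆ stateEvent v y) : v ⊆ u := by
  intro s hs
  by_contra hsu
  obtain ⟨z, hz⟩ := exists_ne (y ⟨s, hs⟩)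
  have hmem : Function.update (holdPath u x) s z ∈ stateEvent u x := fun t => by
    rw [Function.update_of_ne (ne_of_mem_of_not_mem t.2 hsu)]
    exact holdPath_mem u x t
  have := h hmem ⟨s, hs⟩
  simp only [Function.update_self] at this
  exact hz this

/-- This makes `frozenCond` well defined as a function of the conditioning event alone, whichever
`u` and `x` represent it. -/
theorem holdPath_congr {u v : Finset ℝ≥0} {x : u → X} {y : v → X}
    (h : stateEvent u x = stateEvent v y) : holdPath u x = holdPath v y := by
  have huv : u = v := (subset_of_stateEvent_subset h.ge).antisymm (subset_of_stateEvent_subset h.le)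
  subst huv
  have hxy : x = y := funext fun t => by
    have h1 := holdPath_mem u x
    have h2 := h ▸ h1
    rw [← h1 t, h2 t]
  rw [hxy]

theorem stateEvent_ne_univ {u : Finset ℝ≥0} (hu : u.Nonempty) (x : u → X) :
    stateEvent u x ≠ Set.univ := by
  intro h
  have h0 : stateEvent (∅ : Finset ℝ≥0) (fun _ => Classical.arbitrary X) ⊆ stateEvent u x := by
    simp [h]
  exact hu.ne_empty (Finset.subset_empty.mp (subset_of_stateEvent_subset h0))

variable [Fintype X]

open Classical in
/-- The conditional probabilities of the process with initial distribution `p` that never leaves its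
current state. -/
noncomputable def frozenCond (p : X → ℝ) (A C : Set (CTPath X)) : ℝ :=
  if C = Set.univ then ∑ x, p x * A.indicator 1 (fun _ : ℝ≥0 => x)
  else if ∃ (u : Finset ℝ≥0) (x : u → X), C = stateEvent u x ∧ holdPath u x ∈ A then 1 else 0

theorem frozenCond_univ (p : X → ℝ) (A : Set (CTPath X)) :
    frozenCond p A Set.univ = ∑ x, p x * A.indicator 1 (fun _ : ℝ≥0 => x) := if_pos rfl

open Classical in
theorem frozenCond_stateEvent (p : X → ℝ) (A : Set (CTPath X)) {u : Finset ℝ≥0} (hu : u.Nonempty)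
    (x : u → X) : frozenCond p A (stateEvent u x) = A.indicator 1 (holdPath u x) := by
  rw [frozenCond, if_neg (stateEvent_ne_univ hu x), Set.indicator_apply, Pi.one_apply]
  refine if_congr ⟨?_, fun h => ⟨u, x, rfl, h⟩⟩ rfl rfl
  rintro ⟨v, y, h, hA⟩
  rwa [holdPath_congr h]

/-- Events of the future algebra only see the times in `u` and those after `max u`, where `ω` and
the hold path coincide. A conditional bet on such a path therefore has zero gain. -/
theorem frozenCond_eq_indicator (p : X → ℝ) {A : Set (CTPath X)} {u : Finset ℝ≥0} (hu : u.Nonempty)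
    (x : u → X) (hA : A ∈ futureAlgebra X u) {ω : CTPath X} (hω : ω ∈ stateEvent u x)
    (hconst : ∀ s, u.max' hu ≤ s → ω s = ω (u.max' hu)) :
    frozenCond p A (stateEvent u x) = A.indicator 1 ω := by
  classical
  rw [frozenCond_stateEvent p A hu x, Set.indicator_apply, Set.indicator_apply]
  refine if_congr (mem_futureAlgebra_congr hA fun s hs => ?_) rfl rfl
  rcases hs with hs | hs
  · rw [holdPath_of_mem x hs]
    exact (hω ⟨s, hs⟩).symm
  · have hle := (hs _ (u.max'_mem hu)).le
    rw [holdPath_of_le x hu hle, hconst s hle]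
    exact (hω ⟨_, u.max'_mem hu⟩).symm

/-- A path without a loss is found among the constant paths if some bet is unconditional, and among
the hold paths otherwise. -/
theorem coherentOn_frozenCond {p : X → ℝ} (hp : p ∈ stdSimplex ℝ X) :
    CoherentOn (condDomain X) (frozenCond p) := by
  intro n A C c hD
  choose u x hA hC using hD
  simp only at hA hC
  by_cases hempty : ∃ i, u i = ∅
  · have hcover : ∀ ω, ω ∈ ⋃ i, C i := by
      obtain ⟨i, hi⟩ := hempty
      intro ω
      refine Set.mem_iUnion.2 ⟨i, ?_⟩
      rw [hC]
      intro t
      have ht := t.2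
      simp [hi] at ht
    -- `G y` is the total gain on the constant path `y`. Its mean under `p` is zero: unconditional
    -- bets are priced by that mean, and conditional ones gain nothing on constant paths. Hence some
    -- `G y` is non-negative.
    set G : X → ℝ := fun y => ∑ i, c i * (C i).indicator 1 (fun _ : ℝ≥0 => y) *
      (frozenCond p (A i) (C i) - (A i).indicator 1 (fun _ : ℝ≥0 => y)) with hG
    have hsum : ∑ y, p y * G y = 0 := by
      simp only [hG, Finset.mul_sum]
      rw [Finset.sum_comm]
      refine Finset.sum_eq_zero fun i _ => ?_
      rcases (u i).eq_empty_or_nonempty with hi | hi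
      · have hCi : C i = Set.univ := by
          rw [hC, Set.eq_univ_iff_forall]
          intro ω t
          have ht := t.2
          simp [hi] at ht
        rw [hCi]
        simp only [Set.indicator_univ, Pi.one_apply]
        have : ∀ y, p y * (c i * 1 * (frozenCond p (A i) Set.univ
            - (A i).indicator 1 (fun _ : ℝ≥0 => y))) =
            c i * (p y * frozenCond p (A i) Set.univ
              - p y * (A i).indicator 1 (fun _ : ℝ≥0 => y)) := fun y => by ring
        simp only [this]
        rw [← Finset.mul_sum, Finset.sum_sub_distrib, ← Finset.sum_mul, hp.2, one_mul,
          frozenCond_univ, sub_self, mul_zero]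
      · refine Finset.sum_eq_zero fun y _ => ?_
        by_cases hy : (fun _ : ℝ≥0 => y) ∈ C i
        · have := frozenCond_eq_indicator p hi (x i) (hA i) (hC i ▸ hy) (fun _ _ => rfl)
          rw [hC, this]
          simp
        · simp [Set.indicator_of_notMem hy]
    obtain ⟨y, hy⟩ : ∃ y, 0 ≤ G y := by
      by_contra! hneg
      obtain ⟨y, -, hy⟩ : ∃ y ∈ Finset.univ, 0 < p y :=
        Finset.exists_lt_of_sum_lt (f := fun _ => (0 : ℝ)) (by simp [hp.2])
      have : ∑ y, p y * G y < 0 :=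
        Finset.sum_neg' (fun z _ => mul_nonpos_of_nonneg_of_nonpos (hp.1 z) (hneg z).le)
          ⟨y, Finset.mem_univ y, mul_neg_of_pos_of_neg hy (hneg y)⟩
      exact this.ne hsum
    exact ⟨fun _ => y, hcover _, hy⟩
  · have hne : ∀ i, (u i).Nonempty := fun i =>
      Finset.nonempty_iff_ne_empty.2 fun h => hempty ⟨i, h⟩
    -- With the earliest last conditioning time, the hold path is already constant from `max (u j)`
    -- on for every `j`, so every bet that is called gains exactly zero.
    obtain ⟨i, hi⟩ := Finite.exists_min fun i => (u i).max' (hne i)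
    have hmem : holdPath (u i) (x i) ∈ C i := hC i ▸ holdPath_mem _ _
    refine ⟨holdPath (u i) (x i), Set.mem_iUnion.2 ⟨i, hmem⟩, ?_⟩
    refine (Finset.sum_eq_zero fun j _ => ?_).ge
    by_cases hj : holdPath (u i) (x i) ∈ C j
    · have := frozenCond_eq_indicator p (hne j) (x j) (hA j) (hC j ▸ hj) fun s hs => by
        rw [holdPath_of_le _ (hne i) ((hi j).trans hs), holdPath_of_le _ (hne i) (hi j)]
      rw [hC, this]
      simp
    · simp [Set.indicator_of_notMem hj]

/-- The stochastic process with initial distribution `p` that never leaves its current state. -/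
noncomputable def frozenProc {p : X → ℝ} (hp : p ∈ stdSimplex ℝ X) : StochProc X where
  cond := frozenCond p
  coherent := coherentOn_frozenCond hp

variable [DecidableEq X]

theorem frozenProc_initial {p : X → ℝ} (hp : p ∈ stdSimplex ℝ X) (x : X) :
    (frozenProc hp).cond {ω | ω 0 = x} Set.univ = p x := by
  simp only [frozenProc, frozenCond_univ, Set.indicator_apply, Set.mem_ofPred_eq]
  simp

theorem frozenProc_trans {p : X → ℝ} (hp : p ∈ stdSimplex ℝ X) {u : Finset ℝ≥0} (xu : u → X)
    {t s : ℝ≥0} (hut : ∀ r ∈ u, r < t) (hts : t ≤ s) : (frozenProc hp).trans u xu t s = 1 := by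
  classical
  ext x y
  let x' : ↥(insert t u) → X := fun r => if h : (r : ℝ≥0) ∈ u then xu ⟨r, h⟩ else x
  have htu : t ∉ u := fun h => lt_irrefl _ (hut t h)
  -- Present state and history form a single state event with last time `t`, after which the hold
  -- path stays at `x`.
  have hC : ({ω | ω t = x} ∩ stateEvent u xu : Set (CTPath X)) = stateEvent (insert t u) x' := by
    ext ω
    refine ⟨fun h r => ?_, fun h => ⟨?_, fun r => ?_⟩⟩
    · by_cases hr : (r : ℝ≥0) ∈ u
      · simpa only [x', hr, dite_true] using h.2 ⟨r, hr⟩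
      · have hrt : (r : ℝ≥0) = t := (Finset.mem_insert.1 r.2).resolve_right hr
        simp only [x', hrt, htu, dite_false]
        exact h.1
    · change ω t = x
      simpa only [x', htu, dite_false] using h ⟨t, Finset.mem_insert_self t u⟩
    · simpa only [x', r.2, dite_true] using h ⟨r, Finset.mem_insert_of_mem r.2⟩
  have hne : (insert t u).Nonempty := Finset.insert_nonempty t u
  have hmax : (insert t u).max' hne = t := by
    refine le_antisymm (Finset.max'_le _ _ _ fun r hr => ?_)
      (Finset.le_max' _ _ (Finset.mem_insert_self t u))
    rcases Finset.mem_insert.1 hr with rfl | hr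
    · exact le_rfl
    · exact (hut r hr).le
  have hhold : holdPath (insert t u) x' s = x := by
    rw [holdPath_of_le x' hne (hmax.le.trans hts)]
    simp only [x', hmax, htu, dite_false]
  simp only [StochProc.trans, frozenProc, Matrix.of_apply, hC, frozenCond_stateEvent p _ hne,
    Set.indicator_apply, Set.mem_ofPred_eq, hhold, Matrix.one_apply, Pi.one_apply]

theorem frozenProc_wellBehaved {p : X → ℝ} (hp : p ∈ stdSimplex ℝ X) :
    (frozenProc hp).WellBehaved := by
  intro t u xu hut x y
  refine ⟨⟨0, Eventually.of_forall fun h => ?_⟩, fun _ => ⟨0, ?_⟩⟩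
  · simp [frozenProc_trans hp xu hut le_self_add]
  -- To the left, the transition matrix is known to be the identity only once the step is too short
  -- to reach back into the history.
  · have hev : ∀ᶠ h in 𝓝[>] (0 : ℝ≥0), ∀ r ∈ u, r < t - h := by
      rw [Filter.eventually_all_finset]
      intro r hr
      refine nhdsWithin_le_nhds ?_
      filter_upwards [Iio_mem_nhds (tsub_pos_of_lt (hut r hr))] with h hh
      exact lt_tsub_comm.1 hh
    filter_upwards [hev] with h hh
    simp [frozenProc_trans hp xu hh tsub_le_self]

theorem frozenProc_outerDeriv {p : X → ℝ} (hp : p ∈ stdSimplex ℝ X) {t : ℝ≥0} {u : Finset ℝ≥0}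
    (xu : u → X) (hut : ∀ r ∈ u, r < t) : (frozenProc hp).outerDeriv t u xu ⊆ {0} := by
  rintro R (⟨h, -, -, hR⟩ | ⟨h, hh, -, hR⟩)
  · simp only [frozenProc_trans hp xu hut le_self_add, sub_self, smul_zero] at hR
    exact tendsto_nhds_unique hR tendsto_const_nhds
  · have : ∀ i, (frozenProc hp).trans u xu (t - h i) t = 1 := fun i =>
      frozenProc_trans hp xu (hh i).2.2 tsub_le_self
    simp only [this, sub_self, smul_zero] at hR
    exact tendsto_nhds_unique hR tendsto_const_nhds

theorem frozenProc_mem_ictmc {𝒬 : Set (Matrix X X ℝ)} {ℳ : Set (X → ℝ)} (h𝒬 : 0 ∈ 𝒬) {p : X → ℝ}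
    (hp : p ∈ stdSimplex ℝ X) (hpℳ : p ∈ ℳ) : frozenProc hp ∈ ictmc 𝒬 ℳ := by
  refine ⟨frozenProc_wellBehaved hp, ?_, fun t u xu hut =>
    (frozenProc_outerDeriv hp xu hut).trans (Set.singleton_subset_iff.2 h𝒬)⟩
  simpa only [frozenProc_initial] using hpℳ

end Frozen

/-! ### Expectations and updates that involve time `0` only -/

section TimeZero

variable {X Y : Type*}

/-- The initial distribution of a stochastic process. -/
def StochProc.initial (P : StochProc X) (x : X) : ℝ := P.cond {ω | ω 0 = x} Set.univ

theorem StochProc.prob_singleton_zero (P : StochProc X) (x : ({0} : Finset ℝ≥0) → X) :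
    P.prob {0} x = P.initial (x ⟨0, Finset.mem_singleton_self 0⟩) := by
  have : stateEvent {0} x = {ω | ω 0 = x ⟨0, Finset.mem_singleton_self 0⟩} := by
    ext ω
    refine ⟨fun h => h ⟨0, Finset.mem_singleton_self 0⟩, fun h => ?_⟩
    rintro ⟨t, ht⟩
    obtain rfl := Finset.mem_singleton.1 ht
    exact h
  rw [StochProc.prob, this, StochProc.initial]

theorem OutputModel.probSeq_singleton_zero (𝒪 : OutputModel X Y) (x : ({0} : Finset ℝ≥0) → X)
    (O : ({0} : Finset ℝ≥0) → Set Y) :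
    𝒪.probSeq {0} x O =
      𝒪.prob (x ⟨0, Finset.mem_singleton_self 0⟩) (O ⟨0, Finset.mem_singleton_self 0⟩) := by
  rw [OutputModel.probSeq]
  exact Fintype.prod_subsingleton _ _

variable [Fintype X]

theorem sum_singleton_zero (F : (({0} : Finset ℝ≥0) → X) → ℝ) :
    ∑ x, F x = ∑ b, F fun _ => b :=
  Fintype.sum_equiv (Equiv.funUnique ({0} : Finset ℝ≥0) X) _ _ fun x => by
    congr 1
    exact ((Equiv.funUnique _ X).symm_apply_apply x).symm

theorem StochProc.expect_singleton_zero (P : StochProc X) (g : (({0} : Finset ℝ≥0) → X) → ℝ) :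
    P.expect {0} g = ∑ b, P.initial b * g fun _ => b := by
  simp only [StochProc.expect, sum_singleton_zero, P.prob_singleton_zero]

theorem AugmentedProc.outputProb_singleton_zero (P : AugmentedProc X Y)
    (O : ({0} : Finset ℝ≥0) → Set Y) :
    P.outputProb O =
      ∑ b, P.output.prob b (O ⟨0, Finset.mem_singleton_self 0⟩) * P.state.initial b := by
  simp only [AugmentedProc.outputProb, sum_singleton_zero, AugmentedProc.jointProb,
    StochProc.prob_singleton_zero, OutputModel.probSeq_singleton_zero]

theorem AugmentedProc.stateOutputProb_singleton_zero (P : AugmentedProc X Y)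
    (O : ({0} : Finset ℝ≥0) → Set Y) (b : X) :
    P.stateOutputProb (v := {0}) (fun _ => b) O =
      P.output.prob b (O ⟨0, Finset.mem_singleton_self 0⟩) * P.state.initial b := by
  classical
  -- The index type depends on `{0} ∪ {0}`; a variable `w` in its place lets the equality with `{0}`
  -- be substituted.
  have key : ∀ (w : Finset ℝ≥0) (h1 : ({0} : Finset ℝ≥0) ⊆ w) (h2 : ({0} : Finset ℝ≥0) ⊆ w),
      w = {0} →
      (∑ x : w → X, if ∀ t : ({0} : Finset ℝ≥0), x ⟨t, h2 t.2⟩ = b then P.jointProb h1 O x else 0) =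
      P.output.prob b (O ⟨0, Finset.mem_singleton_self 0⟩) * P.state.initial b := by
    rintro w h1 h2 rfl
    simp only [sum_singleton_zero, AugmentedProc.jointProb, StochProc.prob_singleton_zero,
      OutputModel.probSeq_singleton_zero]
    simp
  rw [AugmentedProc.stateOutputProb]
  convert key ({0} ∪ {0}) Finset.subset_union_left Finset.subset_union_right
    (Finset.union_self _)

theorem AugmentedProc.condExpect_singleton_zero (P : AugmentedProc X Y)
    (f : (({0} : Finset ℝ≥0) → X) → ℝ) (O : ({0} : Finset ℝ≥0) → Set Y) :
    P.condExpect f O = ∑ b, f (fun _ => b) *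
      (P.output.prob b (O ⟨0, Finset.mem_singleton_self 0⟩) * P.state.initial b /
        P.outputProb O) := by
  simp only [AugmentedProc.condExpect, sum_singleton_zero,
    AugmentedProc.stateOutputProb_singleton_zero]

end TimeZero

/-! ### The output model with densities `1 / 2` and `|y|` on `[-1, 1]` -/

theorem setIntegral_Icc_abs {a : ℝ} (ha : 0 ≤ a) : ∫ y in Set.Icc (-a) a, |y| = a ^ 2 := by
  rw [integral_Icc_eq_integral_Ioc, ← intervalIntegral.integral_of_le (by linarith),
    ← intervalIntegral.integral_add_adjacent_intervals (b := 0)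
      (continuous_abs.intervalIntegrable _ _) (continuous_abs.intervalIntegrable _ _)]
  have h1 : ∫ y in (-a)..0, |y| = ∫ y in (-a)..0, -y :=
    intervalIntegral.integral_congr fun y hy => by
      rw [Set.uIcc_of_le (by linarith)] at hy
      exact abs_of_nonpos hy.2
  have h2 : ∫ y in (0)..a, |y| = ∫ y in (0)..a, y :=
    intervalIntegral.integral_congr fun y hy => by
      rw [Set.uIcc_of_le ha] at hy
      exact abs_of_nonneg hy.1
  rw [h1, h2, intervalIntegral.integral_neg, integral_id, integral_id]
  ring

/-- The output density in each of the two states. -/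
noncomputable def outputDensity (x : Bool) (y : ℝ) : ℝ := bif x then 1 / 2 else |y|

theorem outputDensity_nonneg (x : Bool) (y : ℝ) : 0 ≤ outputDensity x y := by
  cases x <;> simp [outputDensity]

theorem continuous_outputDensity (x : Bool) : Continuous (outputDensity x) := by
  cases x
  · exact continuous_abs
  · exact continuous_const

theorem setIntegral_Icc_outputDensity (x : Bool) {a : ℝ} (ha : 0 ≤ a) :
    ∫ y in Set.Icc (-a) a, outputDensity x y = bif x then a else a ^ 2 := by
  cases x
  · exact setIntegral_Icc_abs ha
  · simp only [outputDensity, cond_true, setIntegral_const, Real.volume_real_Icc, smul_eq_mul]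
    rw [max_eq_left (by linarith)]
    ring

/-- The Borel output model on `[-1, 1]` with density `1 / 2` in state `true` and `|y|` in state
`false`. -/
noncomputable def absOutput : OutputModel Bool (Set.Icc (-1 : ℝ) 1) where
  events := {O | MeasurableSet O}
  isAlgebra :=
    { empty_mem := by simp
      compl_mem := fun _ h => by simpa using h
      union_mem := fun _ _ h h' => by
        simp only [Set.mem_ofPred_eq] at h h' ⊢
        exact h.union h' }
  prob x O := ∫ y in (Subtype.val '' O : Set ℝ), outputDensity x y
  prob_nonneg x O _ := integral_nonneg fun y => outputDensity_nonneg x y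
  prob_univ x := by
    rw [Set.image_univ, Subtype.range_coe, setIntegral_Icc_outputDensity x zero_le_one]
    cases x <;> simp
  prob_union x O₁ _ O₂ h₂ hd := by
    have hint : ∀ O : Set (Set.Icc (-1 : ℝ) 1),
        IntegrableOn (outputDensity x) (Subtype.val '' O) := fun O =>
      ((continuous_outputDensity x).continuousOn.integrableOn_compact isCompact_Icc).mono_set
        (Subtype.coe_image_subset _ O)
    rw [Set.image_union]
    exact setIntegral_union ((Set.disjoint_image_iff Subtype.val_injective).2 hd)
      ((MeasurableEmbedding.subtype_coe measurableSet_Icc).measurableSet_image.2 h₂)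
      (hint O₁) (hint O₂)

theorem absOutput_prob_Ioo (x : Bool) {a : ℝ} (ha : 0 ≤ a) (ha' : a ≤ 1) :
    absOutput.prob x (Subtype.val ⁻¹' Set.Ioo (-a) a) = bif x then a else a ^ 2 := by
  have : (Subtype.val '' (Subtype.val ⁻¹' Set.Ioo (-a) a : Set (Set.Icc (-1 : ℝ) 1)) : Set ℝ) =
      Set.Ioo (-a) a := by
    rw [Subtype.image_preimage_coe, Set.inter_eq_right]
    exact fun y hy => ⟨by linarith [hy.1], by linarith [hy.2]⟩
  change ∫ y in (Subtype.val '' _ : Set ℝ), outputDensity x y = _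
  rw [this, ← integral_Icc_eq_integral_Ioo, setIntegral_Icc_outputDensity x ha]

/-- The hidden Markov chain with output model `absOutput`, all initial distributions, and all rate
matrices with transition rates at most `1`. -/
noncomputable def absChain : ICTHMC Bool (Set.Icc (-1 : ℝ) 1) where
  rates := {R | IsRateMatrix R ∧ ∀ x, -1 ≤ R x x}
  isRate R hR := hR.1
  rates_nonempty := ⟨0, ⟨by simp, by simp⟩, by simp⟩
  rates_bounded := by
    -- Diagonal entries lie in `[-1, 0]`; the required bound is strict.
    refine ⟨2, fun R hR x => ?_⟩
    have h1 := hR.2 x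
    have h2 := hR.1.2 x
    have h3 := hR.1.1 x (!x) (by cases x <;> simp)
    rw [Fintype.sum_bool] at h2
    have : R x x + R x (!x) = 0 := by cases x <;> simp only [Bool.not_true, Bool.not_false] <;> linarith
    rw [abs_lt]
    constructor <;> linarith
  rates_convex := by
    rintro R hR S hS a b ha hb hab
    refine ⟨⟨fun x y hxy => ?_, fun x => ?_⟩, fun x => ?_⟩
    · simp only [Matrix.add_apply, Matrix.smul_apply, smul_eq_mul]
      exact add_nonneg (mul_nonneg ha (hR.1.1 x y hxy)) (mul_nonneg hb (hS.1.1 x y hxy))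
    · simp only [Matrix.add_apply, Matrix.smul_apply, smul_eq_mul, Finset.sum_add_distrib,
        ← Finset.mul_sum, hR.1.2 x, hS.1.2 x, mul_zero, add_zero]
    · simp only [Matrix.add_apply, Matrix.smul_apply, smul_eq_mul]
      nlinarith [mul_le_mul_of_nonneg_left (hR.2 x) ha, mul_le_mul_of_nonneg_left (hS.2 x) hb]
  rates_rows R hR :=
    ⟨⟨fun x y hxy => (hR x).1.1 x y hxy, fun x => (hR x).1.2 x⟩, fun x => (hR x).2 x⟩
  initial := stdSimplex ℝ Bool
  isPmf := subset_rfl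
  initial_nonempty := ⟨_, single_mem_stdSimplex ℝ true⟩
  output := absOutput

theorem zero_mem_absChain_rates : (0 : Matrix Bool Bool ℝ) ∈ absChain.rates :=
  ⟨⟨by simp, by simp⟩, by simp⟩

theorem initial_of_mem_absChain {P : AugmentedProc Bool (Set.Icc (-1 : ℝ) 1)}
    (hP : P ∈ absChain.procs) :
    P.output = absOutput ∧ (∀ b, 0 ≤ P.state.initial b) ∧
      P.state.initial true + P.state.initial false = 1 := by
  obtain ⟨PX, ⟨-, hPX, -⟩, rfl⟩ := hP
  refine ⟨rfl, hPX.1, ?_⟩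
  have := hPX.2
  rwa [Fintype.sum_bool] at this

/-- The point mass at `true` makes the expected density positive; the one at `false` attains the
lower expectation `-1`. -/
theorem exists_mem_absChain (x : Bool) :
    ∃ P ∈ absChain.procs, ∀ b, P.state.initial b = if b = x then 1 else 0 := by
  have hp := single_mem_stdSimplex ℝ x
  refine ⟨⟨_, frozenProc hp⟩, ⟨_, frozenProc_mem_ictmc zero_mem_absChain_rates hp hp, rfl⟩,
    fun b => ?_⟩
  rw [StochProc.initial, frozenProc_initial, Pi.single_apply]

/-- The two states are `true` and `false`; the output space is `[-1, 1]`. -/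
theorem mainTheorem9 :
    ∃ Z : ICTHMC Bool (Set.Icc (-1 : ℝ) 1),
      -- all initial distributions are allowed
      Z.initial = stdSimplex ℝ Bool ∧
      -- Borel events, with densities `1 / 2` in state `true` and `|y|` in state `false`
      Z.output.events = {O | MeasurableSet O} ∧
      (∀ O, MeasurableSet O →
        Z.output.prob true O = ∫ _y in (Subtype.val '' O : Set ℝ), (1 / 2 : ℝ)) ∧
      (∀ O, MeasurableSet O →
        Z.output.prob false O = ∫ y in (Subtype.val '' O : Set ℝ), |y|) ∧
      ∀ δ : ℕ → ℝ, (∀ i, 0 < δ i ∧ δ i ≤ 1) → Antitone δ → Tendsto δ atTop (𝓝 0) →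
        ∃ (f : (({0} : Finset ℝ≥0) → Bool) → ℝ)
          (y₀ : ({0} : Finset ℝ≥0) → Set.Icc (-1 : ℝ) 1)
          (O : ℕ → ({0} : Finset ℝ≥0) → Set (Set.Icc (-1 : ℝ) 1))
          (lam : ℕ → ℝ) (φ : (({0} : Finset ℝ≥0) → Bool) → ℝ),
          (∀ x, f x = if x ⟨0, by simp⟩ = true then 1 else -1) ∧
          (∀ t, (y₀ t : ℝ) = 0) ∧
          (∀ i t, O i t = Subtype.val ⁻¹' Set.Ioo (-δ i) (δ i)) ∧
          ShrinksTo Z.output O y₀ ∧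
          (∀ i, 0 < lam i) ∧ IsLimitDensity Z.output O lam φ ∧
          0 < upperExpect Z.rates Z.initial {0} φ ∧
          -- the updated expectations that enter the two lower expectations are well defined
          (∀ P ∈ Z.procs, 0 < P.state.expect {0} φ → ∃ e, P.HasPointUpdate f O e) ∧
          (∀ i, 0 < Z.upperOutputProb (O i)) ∧
          -- the two values, and the failure of the limit interpretation
          Z.lowerPointR f O φ = 1 ∧
          Tendsto (fun i => Z.lowerEvent f (O i)) atTop (𝓝 (-1)) ∧
          ¬ Tendsto (fun i => Z.lowerEvent f (O i)) atTop (𝓝 (Z.lowerPointR f O φ)) := by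
  refine ⟨absChain, rfl, rfl, fun O _ => rfl, fun O _ => rfl, fun δ hδ hanti hlim => ?_⟩
  set f : (({0} : Finset ℝ≥0) → Bool) → ℝ := fun x => if x ⟨0, by simp⟩ = true then 1 else -1
    with hf
  set O : ℕ → ({0} : Finset ℝ≥0) → Set (Set.Icc (-1 : ℝ) 1) :=
    fun i _ => Subtype.val ⁻¹' Set.Ioo (-δ i) (δ i) with hO
  set φ : (({0} : Finset ℝ≥0) → Bool) → ℝ := fun x => if x ⟨0, by simp⟩ = true then 1 else 0
    with hφ
  have hout : ∀ P ∈ absChain.procs, ∀ i, P.outputProb (O i) =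
      δ i * P.state.initial true + δ i ^ 2 * P.state.initial false := by
    intro P hP i
    rw [P.outputProb_singleton_zero, (initial_of_mem_absChain hP).1, Fintype.sum_bool]
    simp only [hO, absOutput_prob_Ioo _ (hδ i).1.le (hδ i).2, cond_true, cond_false]
  have hpos : ∀ P ∈ absChain.procs, ∀ i, 0 < P.outputProb (O i) := by
    intro P hP i
    rw [hout P hP]
    obtain ⟨-, h0, h1⟩ := initial_of_mem_absChain hP
    have hd := (hδ i).1
    rcases (h0 true).eq_or_lt with h | h
    · have : P.state.initial false = 1 := by linarith
      rw [← h, this]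
      positivity
    · have := h0 false
      positivity
  have hcond : ∀ P ∈ absChain.procs, ∀ i, P.condExpect f (O i) =
      (P.state.initial true - δ i * P.state.initial false) /
        (P.state.initial true + δ i * P.state.initial false) := by
    intro P hP i
    rw [P.condExpect_singleton_zero, hout P hP, (initial_of_mem_absChain hP).1,
      Fintype.sum_bool]
    simp only [hO, hf, absOutput_prob_Ioo _ (hδ i).1.le (hδ i).2, cond_true, cond_false, if_true,
      Bool.false_eq_true, if_false]
    have hd := (hδ i).1.ne'
    have : δ i * P.state.initial true + δ i ^ 2 * P.state.initial false =
        δ i * (P.state.initial true + δ i * P.state.initial false) := by ring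
    rw [this, ← mul_div_mul_left _ (P.state.initial true + δ i * P.state.initial false) hd]
    ring
  have hexp : ∀ P : StochProc Bool, P.expect {0} φ = P.initial true := by
    intro P
    simp [P.expect_singleton_zero, hφ]
  have hupdate : ∀ P ∈ absChain.procs, 0 < P.state.expect {0} φ → P.HasPointUpdate f O 1 := by
    intro P hP hPφ
    rw [hexp] at hPφ
    refine ⟨hpos P hP, ?_⟩
    simp only [hcond P hP]
    have h := hlim.mul_const (P.state.initial false)
    have h' := (tendsto_const_nhds (x := P.state.initial true)).sub h
    have h'' := (tendsto_const_nhds (x := P.state.initial true)).add h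
    have hdiv := h'.div h'' (by simpa using hPφ.ne')
    simp only [zero_mul, sub_zero, add_zero, div_self hPφ.ne'] at hdiv
    exact hdiv
  obtain ⟨Pt, hPt, hPt'⟩ := exists_mem_absChain true
  obtain ⟨Pf, hPf, hPf'⟩ := exists_mem_absChain false
  have hR : absChain.lowerPointR f O φ = 1 := by
    have : {e | ∃ P ∈ absChain.procs, 0 < P.state.expect {0} φ ∧ P.HasPointUpdate f O e} = {1} := by
      refine Set.eq_singleton_iff_unique_mem.2 ⟨⟨Pt, hPt, ?_⟩, ?_⟩
      · have : 0 < Pt.state.expect {0} φ := by simp [hexp, hPt']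
        exact ⟨this, hupdate Pt hPt this⟩
      · rintro e ⟨P, hP, hPφ, he⟩
        exact tendsto_nhds_unique he.2 (hupdate P hP hPφ).2
    rw [ICTHMC.lowerPointR, this, csInf_singleton]
  have hE : ∀ i, absChain.lowerEvent f (O i) = -1 := by
    intro i
    refine IsLeast.csInf_eq ⟨⟨Pf, hPf, hpos Pf hPf i, ?_⟩, ?_⟩
    · have := (hδ i).1.ne'
      simp [hcond Pf hPf, hPf', this]
    -- Numerator plus denominator is twice the mass of `true`, hence non-negative, so the quotient
    -- is at least `-1`.
    · rintro e ⟨P, hP, hPpos, rfl⟩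
      rw [hout P hP] at hPpos
      obtain ⟨-, h0, -⟩ := initial_of_mem_absChain hP
      have hden : 0 < P.state.initial true + δ i * P.state.initial false := by
        refine pos_of_mul_pos_right (a := δ i) ?_ (hδ i).1.le
        linarith [hPpos]
      rw [hcond P hP, le_div_iff₀ hden]
      linarith [h0 true]
  have hElim : Tendsto (fun i => absChain.lowerEvent f (O i)) atTop (𝓝 (-1)) := by
    simp [hE]
  refine ⟨f, fun _ => ⟨0, by simp⟩, O, δ, φ, fun _ => rfl, fun _ => rfl, fun _ _ => rfl,
    ⟨fun i _ => measurable_subtype_coe measurableSet_Ioo, fun i => ?_, ?_⟩, fun i => (hδ i).1,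
    fun x => ?_, ?_, fun P hP h => ⟨1, hupdate P hP h⟩, fun i => ?_, hR, hElim, ?_⟩
  · refine Set.pi_mono fun _ _ => Set.preimage_mono ?_
    have := hanti (Nat.le_succ i)
    exact Set.Ioo_subset_Ioo (neg_le_neg this) this
  · refine Set.eq_singleton_iff_unique_mem.2 ⟨?_, fun y hy => funext fun t => Subtype.ext ?_⟩
    · simp [box, hO, fun i => (hδ i).1]
    · have hlt : ∀ i, |(y t : ℝ)| < δ i := fun i =>
        abs_lt.2 (Set.mem_iInter.1 hy i t (Set.mem_univ t))
      exact abs_nonpos_iff.1 (ge_of_tendsto' hlim fun i => (hlt i).le)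
  · have hne : ∀ i, δ i ≠ 0 := fun i => (hδ i).1.ne'
    change Tendsto (fun i => absOutput.probSeq {0} x (O i) / δ i) atTop (𝓝 (φ x))
    simp only [OutputModel.probSeq_singleton_zero, hO, hφ,
      absOutput_prob_Ioo _ (hδ _).1.le (hδ _).2]
    cases x ⟨0, by simp⟩
    · simpa [pow_two, hne] using hlim
    · simp [hne]
  · have hmem : ∃ PX ∈ ictmc absChain.rates absChain.initial, (1 : ℝ) = PX.expect {0} φ := by
      obtain ⟨PX, hPX, rfl⟩ := hPt
      exact ⟨PX, hPX, by simpa [hexp] using (hPt' true).symm⟩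
    -- Boundedness has to be shown, since a real `sSup` of an unbounded set is `0` by convention.
    refine zero_lt_one.trans_le (le_csSup ⟨1, ?_⟩ hmem)
    rintro e ⟨PX, hPX, rfl⟩
    obtain ⟨-, h0, h1⟩ := initial_of_mem_absChain ⟨PX, hPX, rfl⟩
    rw [hexp]
    linarith [h0 false]
  -- The bound `2` is crude: the probabilities are at most `1`.
  · refine (hpos Pt hPt i).trans_le (le_csSup ⟨2, ?_⟩ ⟨Pt, hPt, rfl⟩)
    rintro e ⟨P, hP, rfl⟩
    obtain ⟨-, h0, h1⟩ := initial_of_mem_absChain hP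
    rw [hout P hP]
    have hd := hδ i
    have hd2 : δ i ^ 2 ≤ 1 := pow_le_one₀ hd.1.le hd.2
    nlinarith [mul_le_mul_of_nonneg_right hd.2 (h0 true), mul_le_mul_of_nonneg_right hd2 (h0 false)]
  · rw [hR]
    intro h
    have := tendsto_nhds_unique hElim h
    norm_num at this
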